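/- For $\sigma\in S_3$ let $\mathrm{Av}_n(\sigma)$ be the set of permutations $\tau\in S_n$ that avoid $\sigma$, i.e. for which there are no indices $i_1<i_2<i_3$ such that, for all $1\le s<t\le 3$, $\tau(i_s)<\tau(i_t)$ if and only if $\sigma(s)<\sigma(t)$. Let $Z$ be distributed like the sum of two independent Geometric$(2/3)$ random variables, where Geometric$(2/3)$ has mass $\frac23\left(\frac13\right)^k$ at each $k\in\{0,1,2,\dots\}$; that is, $\mathbb{P}(Z=k)=\frac49(k+1)\left(\frac13\right)^k$ for $k\in\{0,1,2,\dots\}$. If, for each $n$, $\pi_n$ is a uniformly random element of $\mathrm{Av}_n(132)$, or if, for each $n$, $\pi_n$ is a uniformly random element of $\mathrm{Av}_n(213)$, then $$\sum_{i=1}^n \mathbf{1}_{\{\pi_n(i)=i\}}\ \overset{d}{\longrightarrow}\ Z\qquad (n\to\infty).$$ -/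

import Mathlib

open MeasureTheory ProbabilityTheory Filter

namespace PatternAvoidance

/-- `τ ∈ S_n` contains the pattern `σ ∈ S_k`: there are indices `i_1 < ⋯ < i_k` such that
`τ(i_s) < τ(i_t)` if and only if `σ(s) < σ(t)`, for all `s < t`. -/
def Contains {n k : ℕ} (τ : Equiv.Perm (Fin n)) (σ : Equiv.Perm (Fin k)) : Prop :=
  ∃ i : Fin k → Fin n, StrictMono i ∧ ∀ s t : Fin k, s < t → (τ (i s) < τ (i t) ↔ σ s < σ t)

/-- `Av_n(σ)`, the set of `σ`-avoiding permutations in `S_n`. -/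
def Av (n : ℕ) {k : ℕ} (σ : Equiv.Perm (Fin k)) : Set (Equiv.Perm (Fin n)) :=
  {τ | ¬ Contains τ σ}

/-- The pattern `132`; positions and values are numbered from `0`. -/
def p132 : Equiv.Perm (Fin 3) := Equiv.swap 1 2

/-- The pattern `213`; positions and values are numbered from `0`. -/
def p213 : Equiv.Perm (Fin 3) := Equiv.swap 0 1

theorem coe_p132 : ⇑p132 = ![0, 2, 1] := by decide

theorem coe_p213 : ⇑p213 = ![1, 0, 2] := by decide

/-- The number of fixed points of a permutation of `{1, …, n}`. -/
def numFixedPoints {n : ℕ} (τ : Equiv.Perm (Fin n)) : ℕ :=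
  ∑ i : Fin n, if τ i = i then 1 else 0

/-- The finite set `S_n` carries the discrete σ-algebra. -/
instance instMeasurableSpacePerm (n : ℕ) : MeasurableSpace (Equiv.Perm (Fin n)) := ⊤

/-- The law Geometric(2/3) on `{0, 1, 2, …}`, with mass `(2/3) (1/3) ^ k` at `k`. -/
noncomputable def geometricTwoThirds : Measure ℕ :=
  geometricMeasure ⟨2 / 3, by norm_num, by norm_num⟩

end PatternAvoidance

open PatternAvoidance

/-!
Splitting at the maximal letter identifies the `132`-avoiding permutations of `n` letters with the
binary trees with `n` nodes, the letters to the left of the maximum all exceeding those to its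
right. The nodes of a tree that account for positions `i` with `w i = i - d`, for a fixed `d`, form
a chain, each lying in the left subtree of the previous one, where it accounts for a fixed point.
Mark `r + 1` fixed points, and let the topmost marked node be replaced by its right subtree: there
remain a tree `t` and the cut off left subtree with `r` marked fixed points, and conversely every
left subtree can be grafted back onto every `t` in exactly one way. Hence the sum of the binomial
coefficients `(number of fixed points).choose r` over all trees has generating function
`X ^ r * c ^ (r + 1)`, where `c` is the Catalan series. By the ballot formula for the coefficients
of `c ^ (r + 1)`, the mean of `(number of fixed points).choose r` is
`(r + 1) * n.choose r / (2 * n).choose r`, which is at most `(r + 1) / 2 ^ r` and converges to it.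
This bound decays fast enough for dominated convergence in the formula which recovers the masses
from the binomial moments, and the limiting masses are `4 / 9 * (k + 1) * (1 / 3) ^ k`. Taking the
reverse-complement preserves the number of fixed points and exchanges `132` with `213`.
-/

namespace PatternAvoidance

section Words

/-- A word over `ℕ` avoids the pattern `132`. -/
def WordAvoids132 (w : List ℕ) : Prop :=
  w.Triplewise fun a b c ↦ ¬(a < c ∧ c < b)

theorem wordAvoids132_map_add_iff {b : ℕ} {s : List ℕ} :
    WordAvoids132 (s.map (b + ·)) ↔ WordAvoids132 s := by
  simp [WordAvoids132, List.triplewise_map]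

theorem wordAvoids132_append_cons_iff {n : ℕ} {s t : List ℕ} (hs : ∀ x ∈ s, x < n)
    (ht : ∀ y ∈ t, y < n) (hst : ∀ x ∈ s, ∀ y ∈ t, x ≠ y) :
    WordAvoids132 (s ++ n :: t) ↔
      WordAvoids132 s ∧ WordAvoids132 t ∧ ∀ x ∈ s, ∀ y ∈ t, y < x := by
  simp only [WordAvoids132, List.triplewise_append, List.triplewise_cons, List.pairwise_cons]
  constructor
  · rintro ⟨hs', ⟨-, ht'⟩, h, -⟩
    refine ⟨hs', ht', fun x hx y hy ↦ ?_⟩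
    have := (h x hx).1 y hy
    have := ht y hy
    have := hst x hx y hy
    omega
  · rintro ⟨hs', ht', h⟩
    refine ⟨hs', ⟨?_, ht'⟩, fun x hx ↦ ⟨fun y hy ↦ ?_, ?_⟩, fun y hy ↦ ?_⟩
    · exact List.pairwise_of_forall_mem_list fun y hy z _ ↦ by have := ht y hy; omega
    · have := h x hx y hy
      omega
    · exact List.pairwise_of_forall_mem_list fun y _ z hz ↦ by have := h x hx z hz; omega
    · refine List.pairwise_of_forall_mem_list fun x hx x' hx' ↦ ?_
      obtain rfl | hy := List.mem_cons.1 hy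
      · have := hs x' hx'
        omega
      · have := h x hx y hy
        omega

theorem perm_range_of_append_perm_range {s t : List ℕ} {n : ℕ}
    (hst : (s ++ t).Perm (List.range n)) (h : ∀ x ∈ s, ∀ y ∈ t, y < x) :
    (∃ s' : List ℕ, s'.Perm (List.range s.length) ∧ s = s'.map (t.length + ·)) ∧
      t.Perm (List.range t.length) := by
  have hn : n = t.length + s.length := by simpa [add_comm] using hst.length_eq.symm
  subst hn
  have sorted : (t.mergeSort ++ s.mergeSort).Pairwise (· ≤ ·) := by
    refine List.pairwise_append.2 ⟨List.pairwise_mergeSort' _ t, List.pairwise_mergeSort' _ s, ?_⟩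
    simp only [List.mem_mergeSort]
    exact fun y hy x hx ↦ (h x hx y hy).le
  have perm : (t.mergeSort ++ s.mergeSort).Perm (List.range (t.length + s.length)) :=
    ((t.mergeSort_perm _).append (s.mergeSort_perm _)).trans (List.perm_append_comm.trans hst)
  have heq := perm.eq_of_pairwise' sorted (List.pairwise_le_range)
  rw [List.range_add] at heq
  obtain ⟨ht, hs⟩ := List.append_inj heq (by simp)
  have hs' : s.Perm ((List.range s.length).map (t.length + ·)) := hs ▸ (s.mergeSort_perm _).symm
  obtain ⟨s', hs, hs'⟩ :=
    (congrFun₂ (List.eq_map_comp_perm (t.length + ·)) s (List.range s.length)).mpr hs'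
  exact ⟨⟨s', hs', hs⟩, ht ▸ (t.mergeSort_perm _).symm⟩

/-- The number of positions `i` of the word `w` with `i - w i = d`, positions being numbered
from `0`. -/
def diagCount : ℤ → List ℕ → ℕ
  | _, [] => 0
  | d, x :: w => (if -(x : ℤ) = d then 1 else 0) + diagCount (d - 1) w

theorem diagCount_append (d : ℤ) (s t : List ℕ) :
    diagCount d (s ++ t) = diagCount d s + diagCount (d - s.length) t := by
  induction s generalizing d with
  | nil => simp [diagCount]
  | cons x s ih =>
    simp only [List.cons_append, diagCount, ih, List.length_cons, Nat.cast_add, Nat.cast_one]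
    rw [show d - 1 - (s.length : ℤ) = d - (s.length + 1) by ring, add_assoc]

theorem diagCount_map_add (d : ℤ) (b : ℕ) (s : List ℕ) :
    diagCount d (s.map (b + ·)) = diagCount (d + b) s := by
  induction s generalizing d with
  | nil => simp [diagCount]
  | cons x s ih =>
    simp only [List.map_cons, diagCount, ih]
    rw [show d - 1 + (b : ℤ) = d + b - 1 by ring]
    congr 1
    exact if_congr (by omega) rfl rfl

theorem diagCount_ofFn {n : ℕ} (d : ℤ) (f : Fin n → ℕ) :
    diagCount d (List.ofFn f) = ∑ i : Fin n, if (i : ℤ) - f i = d then 1 else 0 := by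
  induction n generalizing d with
  | zero => simp [diagCount]
  | succ n ih =>
    rw [List.ofFn_succ, diagCount, ih, Fin.sum_univ_succ]
    congr 1
    · simp
    · refine Finset.sum_congr rfl fun i _ ↦ if_congr ?_ rfl rfl
      simp only [Fin.val_succ, Nat.cast_add, Nat.cast_one]
      omega

end Words

section Trees

open BinaryTree Finset.HasAntidiagonal

/-- The word of a binary tree. The root is the maximal letter, preceded by the word of the left
subtree and followed by the word of the right subtree; the letters of the left subtree are shifted
above those of the right one, so that no `132` arises. -/
def word : BinaryTree Unit → List ℕ
  | nil => []
  | node _ l r => (word l).map (r.numNodes + ·) ++ (l.numNodes + r.numNodes) :: word r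

theorem word_perm_range (t : BinaryTree Unit) : (word t).Perm (List.range t.numNodes) := by
  induction t with
  | nil => simp [word]
  | node _ l r ihl ihr =>
    rw [word, numNodes, List.range_succ, add_comm l.numNodes, List.range_add]
    have hchildren := List.perm_append_comm.trans (ihr.append (ihl.map (r.numNodes + ·)))
    exact List.perm_middle.trans ((hchildren.cons _).trans (List.perm_append_singleton _ _).symm)

theorem lt_numNodes_of_mem_word {t : BinaryTree Unit} {x : ℕ} (hx : x ∈ word t) :
    x < t.numNodes := by
  simpa using (word_perm_range t).subset hx

theorem length_word (t : BinaryTree Unit) : (word t).length = t.numNodes := by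
  simpa using (word_perm_range t).length_eq

theorem wordAvoids132_word (t : BinaryTree Unit) : WordAvoids132 (word t) := by
  induction t with
  | nil => simp [word, WordAvoids132]
  | node _ l r ihl ihr =>
    have hl : ∀ x ∈ (word l).map (r.numNodes + ·),
        r.numNodes ≤ x ∧ x < l.numNodes + r.numNodes := by
      simp only [List.mem_map]
      rintro _ ⟨x, hx, rfl⟩
      have := lt_numNodes_of_mem_word hx
      omega
    have hr : ∀ y ∈ word r, y < r.numNodes := fun y hy ↦ lt_numNodes_of_mem_word hy
    rw [word, wordAvoids132_append_cons_iff (fun x hx ↦ (hl x hx).2)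
      (fun y hy ↦ by have := hr y hy; omega)
      (fun x hx y hy ↦ by have := hl x hx; have := hr y hy; omega)]
    exact ⟨wordAvoids132_map_add_iff.2 ihl, ihr, fun x hx y hy ↦ (hr y hy).trans_le (hl x hx).1⟩

theorem word_injective : Function.Injective word := by
  intro t u h
  have hsize : t.numNodes = u.numNodes := by rw [← length_word, h, length_word]
  induction t generalizing u with
  | nil => cases u <;> simp_all [numNodes]
  | node _ l r ihl ihr =>
    obtain - | ⟨_, l', r'⟩ := u
    · simp [numNodes] at hsize
    have hroot : l'.numNodes + r'.numNodes = l.numNodes + r.numNodes := by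
      simpa [numNodes] using hsize.symm
    rw [word, word, hroot, List.append_cons_inj_of_notMem] at h
    · obtain ⟨hl, -, hr⟩ := h
      have hrsize : r.numNodes = r'.numNodes := by rw [← length_word, hr, length_word]
      rw [hrsize] at hl
      rw [ihl (List.map_injective_iff.2 (add_right_injective _) hl) (by omega), ihr hr hrsize]
    · intro hx
      obtain ⟨x, hx, hmax⟩ := List.mem_map.1 hx
      have := lt_numNodes_of_mem_word hx
      omega
    · intro hx
      have := lt_numNodes_of_mem_word hx
      omega

theorem exists_word_eq {n : ℕ} {w : List ℕ} (hw : w.Perm (List.range n))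
    (havoid : WordAvoids132 w) : ∃ t : BinaryTree Unit, t.numNodes = n ∧ word t = w := by
  induction n using Nat.strong_induction_on generalizing w with
  | _ n ih =>
  obtain - | n := n
  · exact ⟨nil, rfl, by simpa [word, eq_comm] using hw⟩
  obtain ⟨s, t, rfl⟩ := List.append_of_mem (hw.mem_iff.2 (by simp : n ∈ List.range (n + 1)))
  have hst : (s ++ t).Perm (List.range n) := by
    rw [List.range_succ] at hw
    exact (List.perm_middle.symm.trans (hw.trans (List.perm_append_singleton _ _))).cons_inv
  have hlt : ∀ x ∈ s ++ t, x < n := fun x hx ↦ by simpa using hst.subset hx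
  have hdisj := (List.nodup_append.1 (hst.nodup_iff.2 List.nodup_range)).2.2
  rw [wordAvoids132_append_cons_iff (fun x hx ↦ hlt x (by simp [hx]))
    (fun x hx ↦ hlt x (by simp [hx])) hdisj] at havoid
  obtain ⟨havoids, havoidt, hgt⟩ := havoid
  have hlen : s.length + t.length = n := by simpa using hst.length_eq
  obtain ⟨⟨s', hs', rfl⟩, ht⟩ := perm_range_of_append_perm_range hst hgt
  obtain ⟨l, hl, rfl⟩ := ih _ (by omega) hs' (wordAvoids132_map_add_iff.1 havoids)
  obtain ⟨r, hr, rfl⟩ := ih _ (by omega) ht havoidt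
  rw [← hl, ← hr] at hlen
  exact ⟨l △ r, by rw [numNodes, hlen], by rw [word, hlen, hr]⟩

theorem diagCount_word_node (d : ℤ) (l r : BinaryTree Unit) :
    diagCount d (word (l △ r)) = diagCount (d + r.numNodes) (word l) +
      ((if d = -r.numNodes then 1 else 0) + diagCount (d - l.numNodes - 1) (word r)) := by
  rw [word, diagCount_append, diagCount_map_add, diagCount, List.length_map, length_word]
  congr 2
  exact if_congr (by omega) rfl rfl

theorem diagCount_word_eq_zero {d : ℤ} {t : BinaryTree Unit} (h : t.numNodes ≤ d.natAbs) :
    diagCount d (word t) = 0 := by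
  induction t generalizing d with
  | nil => rfl
  | node _ l r ihl ihr =>
    rw [numNodes] at h
    rw [diagCount_word_node, ihl (by omega), ihr (by omega), if_neg (by omega)]

/-- Grafting `s` onto `t` along the diagonal `d`. For `d.natAbs ≤ t.numNodes` exactly one node can
be inserted into `t`, with `s` as left subtree and the subtree of `t` that it displaces as right
subtree, so as to account for a position `i` of the resulting word `w` with `i - w i = d`;
`graft d t s` is the result. For other `d` the value is of no significance. -/
def graft : ℤ → BinaryTree Unit → BinaryTree Unit → BinaryTree Unit
  | _, nil, s => s △ nil
  | d, node _ l r, s =>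
    if d = -(l △ r).numNodes then s △ (l △ r)
    else if d ≤ l.numNodes - r.numNodes then graft (d + r.numNodes) l s △ r
    else l △ graft (d - l.numNodes - 1) r s

theorem numNodes_graft (d : ℤ) (t s : BinaryTree Unit) :
    (graft d t s).numNodes = t.numNodes + s.numNodes + 1 := by
  induction t generalizing d with
  | nil => simp [graft, numNodes]
  | node _ l r ihl ihr =>
    rw [graft]
    split_ifs <;> simp only [numNodes, ihl, ihr] <;> omega

theorem graft_neg_numNodes (t s : BinaryTree Unit) : graft (-t.numNodes) t s = s △ t := by
  cases t <;> simp [graft]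

/-- All ways to undo a grafting along the diagonal `d`: for each node of `t` that accounts for a
position `i` of the word `w` of `t` with `i - w i = d`, the tree obtained by replacing that node by
its right subtree, paired with its left subtree. -/
def prunings : ℤ → BinaryTree Unit → List (BinaryTree Unit × BinaryTree Unit)
  | _, nil => []
  | d, node _ l r =>
    (prunings (d + r.numNodes) l).map (fun p ↦ (p.1 △ r, p.2)) ++
      ((if d = -r.numNodes then [(r, l)] else []) ++
        (prunings (d - l.numNodes - 1) r).map fun p ↦ (l △ p.1, p.2))

theorem graft_eq_of_mem_prunings {d : ℤ} {t : BinaryTree Unit}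
    {p : BinaryTree Unit × BinaryTree Unit} (hp : p ∈ prunings d t) :
    d.natAbs ≤ p.1.numNodes ∧ graft d p.1 p.2 = t := by
  induction t generalizing d p with
  | nil => simp [prunings] at hp
  | node _ l r ihl ihr =>
    simp only [prunings, List.mem_append, List.mem_map] at hp
    obtain ⟨q, hq, rfl⟩ | hp | ⟨q, hq, rfl⟩ := hp
    · obtain ⟨hd, rfl⟩ := ihl hq
      simp only [numNodes, graft]
      rw [if_neg (by omega), if_pos (by omega)]
      exact ⟨by omega, rfl⟩
    · obtain ⟨rfl, rfl⟩ : d = -r.numNodes ∧ p = (r, l) := by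
        split_ifs at hp <;> simp_all
      exact ⟨by simp, graft_neg_numNodes r l⟩
    · obtain ⟨hd, rfl⟩ := ihr hq
      simp only [numNodes, graft]
      rw [if_neg (by omega), if_neg (by omega)]
      exact ⟨by omega, rfl⟩

theorem mem_prunings_graft {d : ℤ} {t : BinaryTree Unit} (h : d.natAbs ≤ t.numNodes)
    (s : BinaryTree Unit) : (t, s) ∈ prunings d (graft d t s) := by
  induction t generalizing d with
  | nil =>
    obtain rfl : d = 0 := by simpa using h
    simp [graft, prunings]
  | node _ l r ihl ihr =>
    rw [numNodes] at h
    rw [graft]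
    split_ifs with hroot hleft
    · simp [prunings, hroot]
    · rw [numNodes] at hroot
      have := ihl (d := d + r.numNodes) (by omega)
      simp [prunings, this]
    · have := ihr (d := d - l.numNodes - 1) (by omega)
      simp [prunings, this]

theorem mem_prunings {d : ℤ} {t : BinaryTree Unit} {p : BinaryTree Unit × BinaryTree Unit} :
    p ∈ prunings d t ↔ d.natAbs ≤ p.1.numNodes ∧ graft d p.1 p.2 = t :=
  ⟨graft_eq_of_mem_prunings, fun ⟨hd, h⟩ ↦ h ▸ mem_prunings_graft hd p.2⟩

theorem numNodes_lt_of_mem_prunings {d : ℤ} {t : BinaryTree Unit}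
    {p : BinaryTree Unit × BinaryTree Unit} (hp : p ∈ prunings d t) :
    p.1.numNodes < t.numNodes := by
  rw [← (mem_prunings.1 hp).2, numNodes_graft]
  omega

theorem nodup_prunings (d : ℤ) (t : BinaryTree Unit) : (prunings d t).Nodup := by
  induction t generalizing d with
  | nil => exact List.nodup_nil
  | node _ l r ihl ihr =>
    have hsize {e : ℤ} {u} {p : BinaryTree Unit × BinaryTree Unit} (hp : p ∈ prunings e u) :
        p.1.numNodes < u.numNodes ∧ e.natAbs ≤ p.1.numNodes :=
      ⟨numNodes_lt_of_mem_prunings hp, (mem_prunings.1 hp).1⟩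
    have hleft : ((prunings (d + r.numNodes) l).map fun p ↦ (p.1 △ r, p.2)).Nodup :=
      (ihl _).map fun p q h ↦ by simpa [Prod.ext_iff] using h
    have hright : ((prunings (d - l.numNodes - 1) r).map fun p ↦ (l △ p.1, p.2)).Nodup :=
      (ihr _).map fun p q h ↦ by simpa [Prod.ext_iff] using h
    have hroot : (if d = -r.numNodes then [(r, l)] else []).Nodup := by split_ifs <;> simp
    rw [prunings, List.nodup_append', List.nodup_append']
    refine ⟨hleft, ⟨hroot, hright, ?_⟩, ?_⟩
    · simp only [List.disjoint_left, List.mem_map, List.mem_ite_nil_right, List.mem_singleton]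
      rintro _ ⟨hd, rfl⟩ ⟨q, hq, h⟩
      have := (hsize hq).2
      have := congrArg (fun p ↦ p.1.numNodes) h
      simp only [numNodes] at this
      omega
    · simp only [List.disjoint_left, List.mem_map, List.mem_append, List.mem_ite_nil_right,
        List.mem_singleton]
      rintro _ ⟨q, hq, rfl⟩ (⟨-, h⟩ | ⟨q', -, h⟩)
      · have := congrArg (fun p ↦ p.1.numNodes) h
        simp only [numNodes] at this
        omega
      · have := (hsize hq).1
        simp_all

theorem choose_diagCount_word_succ (d : ℤ) (t : BinaryTree Unit) (k : ℕ) :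
    (diagCount d (word t)).choose (k + 1) =
      ((prunings d t).map fun p ↦ (diagCount 0 (word p.2)).choose k).sum := by
  induction t generalizing d with
  | nil => rfl
  | node _ l r ihl ihr =>
    rw [diagCount_word_node]
    simp only [prunings, List.map_append, List.map_map, List.sum_append, Function.comp_def, ← ihl,
      ← ihr]
    obtain rfl | hd := eq_or_ne d (-r.numNodes)
    · have hright : diagCount (-r.numNodes - l.numNodes - 1) (word r) = 0 :=
        diagCount_word_eq_zero (by omega)
      simpa [hright, add_comm] using Nat.choose_succ_succ' (diagCount 0 (word l)) k
    · have hside : diagCount (d + r.numNodes) (word l) = 0 ∨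
          diagCount (d - l.numNodes - 1) (word r) = 0 := by
        by_cases h : d ≤ l.numNodes - r.numNodes
        · exact .inr (diagCount_word_eq_zero (by omega))
        · exact .inl (diagCount_word_eq_zero (by omega))
      obtain hl | hr := hside <;> simp [*]

theorem sum_prunings {M : Type*} [AddCommMonoid M] (n : ℕ) (d : ℤ)
    (f : BinaryTree Unit × BinaryTree Unit → M) :
    ∑ t ∈ treesOfNumNodesEq (n + 1), ((prunings d t).map f).sum =
      ∑ ab ∈ antidiagonal n with d.natAbs ≤ ab.1,
        ∑ p ∈ treesOfNumNodesEq ab.1 ×ˢ treesOfNumNodesEq ab.2, f p := by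
  simp only [← List.sum_toFinset _ (nodup_prunings d _)]
  rw [Finset.sum_sigma', Finset.sum_sigma']
  refine Finset.sum_bij' (fun x _ ↦ ⟨(x.2.1.numNodes, x.2.2.numNodes), x.2⟩)
    (fun x _ ↦ ⟨graft d x.2.1 x.2.2, x.2⟩) ?_ ?_ ?_ ?_ ?_
  · rintro ⟨t, p⟩ h
    simp only [Finset.mem_sigma, mem_treesOfNumNodesEq, List.mem_toFinset, mem_prunings] at h
    obtain ⟨ht, hd, rfl⟩ := h
    rw [numNodes_graft] at ht
    have hnodes : p.1.numNodes + p.2.numNodes = n := by omega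
    simp [hd, hnodes]
  · rintro ⟨⟨a, b⟩, p⟩ h
    simp only [Finset.mem_sigma, Finset.mem_filter, mem_antidiagonal, Finset.mem_product,
      mem_treesOfNumNodesEq] at h
    obtain ⟨⟨hab, hd⟩, rfl, rfl⟩ := h
    simp [mem_prunings, numNodes_graft, hab, hd]
  · rintro ⟨t, p⟩ h
    simp only [Finset.mem_sigma, List.mem_toFinset, mem_prunings] at h
    simp [h.2.2]
  · rintro ⟨⟨a, b⟩, p⟩ h
    simp only [Finset.mem_sigma, Finset.mem_product, mem_treesOfNumNodesEq] at h
    simp [h.2.1, h.2.2]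
  · exact fun _ _ ↦ rfl

theorem sum_choose_diagCount_word_succ (n k : ℕ) :
    ∑ t ∈ treesOfNumNodesEq (n + 1), (diagCount 0 (word t)).choose (k + 1) =
      ∑ ab ∈ antidiagonal n,
        catalan ab.1 * ∑ s ∈ treesOfNumNodesEq ab.2, (diagCount 0 (word s)).choose k := by
  simp [choose_diagCount_word_succ, sum_prunings, Finset.sum_product,
    treesOfNumNodesEq_card_eq_catalan]

end Trees

section Catalan

open PowerSeries

theorem coeff_succ_catalanSeries_pow (r m : ℕ) :
    coeff (m + 1) (catalanSeries ^ (r + 2)) =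
      coeff (m + 1) (catalanSeries ^ (r + 1)) + coeff m (catalanSeries ^ (r + 3)) := by
  have h : catalanSeries ^ (r + 2) = catalanSeries ^ (r + 1) + catalanSeries ^ (r + 3) * X := by
    calc catalanSeries ^ (r + 2) = catalanSeries ^ (r + 1) * catalanSeries := pow_succ _ _
      _ = catalanSeries ^ (r + 1) * (catalanSeries ^ 2 * X + 1) := by
        rw [catalanSeries_sq_mul_X_add_one]
      _ = catalanSeries ^ (r + 1) + catalanSeries ^ (r + 3) * X := by ring
  rw [h, map_add, coeff_succ_mul_X]

theorem add_mul_coeff_catalanSeries_pow (r m : ℕ) :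
    (m + r + 1) * coeff m (catalanSeries ^ (r + 1)) = (r + 1) * (2 * m + r).choose m := by
  induction m generalizing r with
  | zero => simp
  | succ m ihm =>
    induction r with
    | zero =>
      simpa [Nat.centralBinom_eq_two_mul_choose] using succ_mul_catalan_eq_centralBinom (m + 1)
    | succ r ihr =>
      have hm := ihm (r + 2)
      have habsorb := Nat.choose_succ_right_eq (2 * m + r + 2) m
      rw [show 2 * m + r + 2 - m = m + r + 2 by omega] at habsorb
      have hpascal := Nat.choose_succ_succ' (2 * m + r + 2) m
      rw [show 2 * (m + 1) + r = 2 * m + r + 2 by ring] at ihr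
      rw [show 2 * m + (r + 2) = 2 * m + r + 2 by ring] at hm
      rw [show 2 * (m + 1) + (r + 1) = 2 * m + r + 2 + 1 by ring, hpascal,
        coeff_succ_catalanSeries_pow]
      apply Nat.eq_of_mul_eq_mul_left (show 0 < m + r + 2 by omega)
      zify at *
      linear_combination (m + r + 3 : ℤ) * ihr + (m + r + 2 : ℤ) * hm - habsorb

theorem coeff_X_pow_mul_catalanSeries_pow_mul_choose (r n : ℕ) :
    coeff n (X ^ r * catalanSeries ^ (r + 1)) * (2 * n).choose r =
      (r + 1) * n.choose r * catalan n := by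
  obtain hn | ⟨m, rfl⟩ := (lt_or_ge n r).imp_right Nat.exists_eq_add_of_le'
  · rw [coeff_X_pow_mul', if_neg (by omega), Nat.choose_eq_zero_of_lt hn]
    ring
  · rw [coeff_X_pow_mul]
    have hchoose : (2 * (m + r)).choose (m + r) * (m + r).choose r =
        (2 * (m + r)).choose r * (2 * m + r).choose m := by
      rw [Nat.choose_mul (by omega), Nat.add_sub_cancel]
      congr 2
      omega
    rw [← Nat.centralBinom_eq_two_mul_choose, ← succ_mul_catalan_eq_centralBinom] at hchoose
    have := add_mul_coeff_catalanSeries_pow r m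
    apply Nat.eq_of_mul_eq_mul_left (show 0 < m + r + 1 by omega)
    zify at *
    linear_combination ((2 * (m + r)).choose r : ℤ) * this - (r + 1 : ℤ) * hchoose

theorem coeff_X_pow_mul_catalanSeries_pow_div_catalan (r n : ℕ) :
    ((coeff n (X ^ r * catalanSeries ^ (r + 1)) : ℕ) : ℝ) / catalan n =
      (r + 1) * (n.choose r / (2 * n).choose r) := by
  have hcatalan : catalan n ≠ 0 := by
    intro h
    have := succ_mul_catalan_eq_centralBinom n
    rw [h] at this
    exact n.centralBinom_ne_zero this.symm
  obtain hr | hr := lt_or_ge n r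
  · rw [coeff_X_pow_mul', if_neg (by omega), Nat.choose_eq_zero_of_lt hr]
    simp
  · have hchoose : (2 * n).choose r ≠ 0 := (Nat.choose_pos (by omega)).ne'
    rw [← mul_div_assoc, div_eq_div_iff (by exact_mod_cast hcatalan) (by exact_mod_cast hchoose)]
    exact_mod_cast coeff_X_pow_mul_catalanSeries_pow_mul_choose r n

theorem sum_choose_diagCount_word (n r : ℕ) :
    ∑ t ∈ BinaryTree.treesOfNumNodesEq n, (diagCount 0 (word t)).choose r =
      coeff n (X ^ r * catalanSeries ^ (r + 1)) := by
  induction r generalizing n with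
  | zero => simp [BinaryTree.treesOfNumNodesEq_card_eq_catalan]
  | succ r ih =>
    obtain - | n := n
    · simp [word, diagCount]
    · have h : (X : ℕ⟦X⟧) ^ (r + 1) * catalanSeries ^ (r + 1 + 1) =
          catalanSeries * (X ^ r * catalanSeries ^ (r + 1)) * X := by ring
      rw [sum_choose_diagCount_word_succ, h, coeff_succ_mul_X, coeff_mul]
      simp only [ih, catalanSeries_coeff]

theorem two_pow_mul_choose_le (n r : ℕ) : 2 ^ r * n.choose r ≤ (2 * n).choose r := by
  induction r with
  | zero => simp
  | succ r ih =>
    refine le_of_mul_le_mul_right ?_ (Nat.succ_pos r)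
    calc 2 ^ (r + 1) * n.choose (r + 1) * (r + 1)
        = 2 ^ r * n.choose r * (2 * (n - r)) := by
          rw [mul_assoc, Nat.choose_succ_right_eq]
          ring
      _ ≤ (2 * n).choose r * (2 * n - r) := Nat.mul_le_mul ih (by omega)
      _ = (2 * n).choose (r + 1) * (r + 1) := (Nat.choose_succ_right_eq _ _).symm

theorem choose_div_choose_two_mul_le (n r : ℕ) :
    (n.choose r : ℝ) / (2 * n).choose r ≤ (1 / 2) ^ r := by
  obtain h | h := ((2 * n).choose r).eq_zero_or_pos
  · simp [h]
  · rw [div_le_iff₀ (by exact_mod_cast h), one_div, inv_pow, ← div_eq_inv_mul,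
      le_div_iff₀' (by positivity)]
    exact_mod_cast two_pow_mul_choose_le n r

theorem tendsto_choose_div_choose_two_mul (r : ℕ) :
    Tendsto (fun n : ℕ ↦ (n.choose r : ℝ) / (2 * n).choose r) atTop (nhds ((1 / 2) ^ r)) := by
  have htwo : Tendsto (fun n : ℕ ↦ 2 * n) atTop atTop := tendsto_id.const_mul_atTop' two_pos
  refine ((isEquivalent_choose r).div
    ((isEquivalent_choose r).comp_tendsto htwo)).symm.tendsto_nhds (tendsto_const_nhds.congr' ?_)
  filter_upwards [eventually_ne_atTop 0] with n hn
  have : (n : ℝ) ≠ 0 := by exact_mod_cast hn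
  simp only [Pi.div_apply, Function.comp_apply, Nat.cast_mul, Nat.cast_ofNat]
  rw [show (2 * n : ℝ) ^ r = n ^ r * 2 ^ r by ring]
  field_simp
  rw [← mul_pow]
  norm_num

end Catalan

section Permutations

open PowerSeries

theorem contains_iff_exists_triple {n : ℕ} (τ : Equiv.Perm (Fin n)) (σ : Equiv.Perm (Fin 3)) :
    Contains τ σ ↔ ∃ i j k : Fin n, i < j ∧ j < k ∧ (τ i < τ j ↔ σ 0 < σ 1) ∧
      (τ i < τ k ↔ σ 0 < σ 2) ∧ (τ j < τ k ↔ σ 1 < σ 2) := by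
  constructor
  · rintro ⟨f, hf, h⟩
    exact ⟨f 0, f 1, f 2, hf (by decide), hf (by decide), h 0 1 (by decide), h 0 2 (by decide),
      h 1 2 (by decide)⟩
  · rintro ⟨i, j, k, hij, hjk, h01, h02, h12⟩
    refine ⟨![i, j, k], by simp [Fin.strictMono_iff_lt_succ, Fin.forall_fin_two, hij, hjk], ?_⟩
    simp [Fin.forall_fin_succ, h01, h02, h12]

theorem contains_p132_iff {n : ℕ} (τ : Equiv.Perm (Fin n)) :
    Contains τ p132 ↔ ∃ i j k : Fin n, i < j ∧ j < k ∧ τ i < τ k ∧ τ k < τ j := by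
  rw [contains_iff_exists_triple]
  refine exists₃_congr fun i j k ↦ and_congr_right fun _ ↦ and_congr_right fun hjk ↦ ?_
  have hne : τ j ≠ τ k := τ.injective.ne hjk.ne
  have hσ : p132 0 < p132 1 ∧ p132 0 < p132 2 ∧ ¬p132 1 < p132 2 := by decide
  grind

theorem contains_p213_iff {n : ℕ} (τ : Equiv.Perm (Fin n)) :
    Contains τ p213 ↔ ∃ i j k : Fin n, i < j ∧ j < k ∧ τ j < τ i ∧ τ i < τ k := by
  rw [contains_iff_exists_triple]
  refine exists₃_congr fun i j k ↦ and_congr_right fun hij ↦ and_congr_right fun _ ↦ ?_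
  have hne : τ i ≠ τ j := τ.injective.ne hij.ne
  have hσ : ¬p213 0 < p213 1 ∧ p213 0 < p213 2 ∧ p213 1 < p213 2 := by decide
  grind

/-- The one-line notation of a permutation of `Fin n`, as a word over `ℕ`. -/
def oneLine {n : ℕ} (τ : Equiv.Perm (Fin n)) : List ℕ :=
  List.ofFn fun i ↦ (τ i : ℕ)

theorem oneLine_injective {n : ℕ} : Function.Injective (oneLine (n := n)) := by
  intro τ τ' h
  ext i
  exact congrFun (List.ofFn_injective h) i

theorem oneLine_perm_range {n : ℕ} (τ : Equiv.Perm (Fin n)) :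
    (oneLine τ).Perm (List.range n) := by
  refine (List.perm_ext_iff_of_nodup ?_ List.nodup_range).2 fun x ↦ ?_
  · exact List.nodup_ofFn.2 (Fin.val_injective.comp τ.injective)
  · rw [oneLine, List.mem_ofFn, List.mem_range]
    exact ⟨by rintro ⟨i, rfl⟩; exact (τ i).isLt, fun hx ↦ ⟨τ.symm ⟨x, hx⟩, by simp⟩⟩

theorem exists_oneLine_eq {n : ℕ} {w : List ℕ} (hw : w.Perm (List.range n)) :
    ∃ τ : Equiv.Perm (Fin n), oneLine τ = w := by
  obtain rfl : w.length = n := by simpa using hw.length_eq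
  have hlt (i : Fin w.length) : w[i] < w.length := by simpa using hw.subset (w.getElem_mem i.isLt)
  have hinj : Function.Injective fun i ↦ (⟨w[i], hlt i⟩ : Fin w.length) := fun i j hij ↦
    List.nodup_iff_injective_getElem.1 (hw.nodup_iff.2 List.nodup_range) (congrArg Fin.val hij)
  exact ⟨.ofBijective _ (Finite.injective_iff_bijective.1 hinj), List.ofFn_getElem⟩

theorem wordAvoids132_oneLine_iff {n : ℕ} (τ : Equiv.Perm (Fin n)) :
    WordAvoids132 (oneLine τ) ↔ τ ∈ Av n p132 := by
  rw [Av, Set.mem_ofPred_eq, contains_p132_iff, WordAvoids132, List.triplewise_iff_getElem]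
  simp only [oneLine, List.length_ofFn, List.getElem_ofFn, Fin.val_fin_lt]
  constructor
  · rintro h ⟨i, j, k, hij, hjk, hik⟩
    exact h i j k hij hjk k.isLt hik
  · exact fun h i j k hij hjk hk hik ↦ h ⟨⟨i, _⟩, ⟨j, _⟩, ⟨k, hk⟩, hij, hjk, hik⟩

theorem diagCount_oneLine {n : ℕ} (τ : Equiv.Perm (Fin n)) :
    diagCount 0 (oneLine τ) = numFixedPoints τ := by
  rw [oneLine, diagCount_ofFn, numFixedPoints]
  refine Finset.sum_congr rfl fun i _ ↦ if_congr ?_ rfl rfl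
  rw [Fin.ext_iff]
  omega

open scoped Classical in
theorem image_oneLine_av_p132 (n : ℕ) :
    ({τ | τ ∈ Av n p132} : Finset (Equiv.Perm (Fin n))).image oneLine =
      (BinaryTree.treesOfNumNodesEq n).image word := by
  ext w
  simp only [Finset.mem_image, Finset.mem_filter_univ, BinaryTree.mem_treesOfNumNodesEq]
  constructor
  · rintro ⟨τ, hτ, rfl⟩
    exact exists_word_eq (oneLine_perm_range τ) ((wordAvoids132_oneLine_iff τ).2 hτ)
  · rintro ⟨t, rfl, rfl⟩
    obtain ⟨τ, hτ⟩ := exists_oneLine_eq (word_perm_range t)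
    exact ⟨τ, (wordAvoids132_oneLine_iff τ).1 (hτ ▸ wordAvoids132_word t), hτ⟩

open scoped Classical in
theorem sum_choose_numFixedPoints_av_p132 (n r : ℕ) :
    ∑ τ with τ ∈ Av n p132, (numFixedPoints τ).choose r =
      coeff n (X ^ r * catalanSeries ^ (r + 1)) := by
  simp only [← diagCount_oneLine]
  rw [← sum_choose_diagCount_word,
    ← Finset.sum_image (f := fun w ↦ (diagCount 0 w).choose r) oneLine_injective.injOn,
    image_oneLine_av_p132, Finset.sum_image word_injective.injOn]

/-- The reverse-complement of a permutation. -/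
def revCompl {n : ℕ} (τ : Equiv.Perm (Fin n)) : Equiv.Perm (Fin n) :=
  Fin.revPerm.trans (τ.trans Fin.revPerm)

theorem revCompl_apply {n : ℕ} (τ : Equiv.Perm (Fin n)) (i : Fin n) :
    revCompl τ i = (τ i.rev).rev := rfl

theorem revCompl_involutive {n : ℕ} : Function.Involutive (revCompl (n := n)) := by
  intro τ
  ext i
  simp [revCompl_apply]

theorem numFixedPoints_revCompl {n : ℕ} (τ : Equiv.Perm (Fin n)) :
    numFixedPoints (revCompl τ) = numFixedPoints τ := by
  rw [numFixedPoints, numFixedPoints, ← Equiv.sum_comp Fin.revPerm]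
  simp [revCompl_apply]

theorem revCompl_mem_av_p213_iff {n : ℕ} (τ : Equiv.Perm (Fin n)) :
    revCompl τ ∈ Av n p213 ↔ τ ∈ Av n p132 := by
  rw [Av, Av, Set.mem_ofPred_eq, Set.mem_ofPred_eq, contains_p132_iff, contains_p213_iff]
  refine not_congr ⟨?_, ?_⟩
  · rintro ⟨i, j, k, hij, hjk, hji, hik⟩
    exact ⟨k.rev, j.rev, i.rev, Fin.rev_lt_rev.2 hjk, Fin.rev_lt_rev.2 hij, Fin.rev_lt_rev.1 hik,
      Fin.rev_lt_rev.1 hji⟩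
  · rintro ⟨i, j, k, hij, hjk, hik, hkj⟩
    refine ⟨k.rev, j.rev, i.rev, Fin.rev_lt_rev.2 hjk, Fin.rev_lt_rev.2 hij, ?_, ?_⟩ <;>
      simpa [revCompl_apply]

open scoped Classical in
theorem sum_choose_numFixedPoints_av {σ : Equiv.Perm (Fin 3)} (hσ : σ = p132 ∨ σ = p213)
    (n r : ℕ) :
    ∑ τ with τ ∈ Av n σ, (numFixedPoints τ).choose r =
      coeff n (X ^ r * catalanSeries ^ (r + 1)) := by
  obtain rfl | rfl := hσ
  · exact sum_choose_numFixedPoints_av_p132 n r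
  · rw [← sum_choose_numFixedPoints_av_p132]
    refine (Finset.sum_equiv revCompl_involutive.toPerm ?_ ?_).symm <;>
      simp [revCompl_mem_av_p213_iff, numFixedPoints_revCompl]

end Permutations

section BinomialMoments

theorem hasSum_alternating_choose_mul_choose (k m : ℕ) :
    HasSum (fun j ↦ (-1 : ℝ) ^ j * (k + j).choose k * m.choose (k + j))
      (if m = k then 1 else 0) := by
  obtain hk | hk := lt_or_ge m k
  · have h0 (j : ℕ) : m.choose (k + j) = 0 := Nat.choose_eq_zero_of_lt (by omega)
    simp [h0, hk.ne]
  have hfactor (j : ℕ) : (-1 : ℝ) ^ j * (k + j).choose k * m.choose (k + j) =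
      m.choose k * ((-1 : ℝ) ^ j * (m - k).choose j) := by
    have h := Nat.choose_mul (n := m) (Nat.le_add_right k j)
    rw [Nat.add_sub_cancel_left] at h
    have h' : (m.choose (k + j) : ℝ) * (k + j).choose k = m.choose k * (m - k).choose j := by
      exact_mod_cast h
    linear_combination (-1 : ℝ) ^ j * h'
  have halternating : ∑ j ∈ Finset.range (m - k + 1), (-1 : ℝ) ^ j * (m - k).choose j =
      if m - k = 0 then 1 else 0 := by
    exact_mod_cast Int.alternating_sum_range_choose (n := m - k)
  have hsum : HasSum (fun j ↦ (-1 : ℝ) ^ j * (m - k).choose j) (if m - k = 0 then 1 else 0) := by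
    rw [← halternating]
    refine hasSum_sum_of_ne_finset_zero fun j hj ↦ ?_
    rw [Finset.mem_range] at hj
    simp [Nat.choose_eq_zero_of_lt (show m - k < j by omega)]
  have hvalue : (if m = k then 1 else 0 : ℝ) = m.choose k * if m - k = 0 then 1 else 0 := by
    obtain rfl | hne := eq_or_ne m k
    · simp
    · rw [if_neg hne, if_neg (by omega), mul_zero]
  simpa only [hfactor, hvalue] using hsum.mul_left (m.choose k : ℝ)

theorem hasSum_integral_choose {Ω : Type*} [MeasurableSpace Ω] {P : Measure Ω} {X : Ω → ℕ}
    (hX : AEMeasurable X P) (hint : ∀ r, Integrable (fun ω ↦ ((X ω).choose r : ℝ)) P) {k : ℕ}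
    (hsum : Summable fun j ↦ ((k + j).choose k : ℝ) * ∫ ω, ((X ω).choose (k + j) : ℝ) ∂P) :
    HasSum (fun j ↦ (-1 : ℝ) ^ j * (k + j).choose k * ∫ ω, ((X ω).choose (k + j) : ℝ) ∂P)
      (P.real {ω | X ω = k}) := by
  have hmass : ∫ ω, (if X ω = k then 1 else 0 : ℝ) ∂P = P.real {ω | X ω = k} := by
    have hnull : NullMeasurableSet {ω | X ω = k} P :=
      hX.nullMeasurable (measurableSet_singleton k)
    simpa [Set.indicator_apply] using integral_indicator₀ (f := fun _ ↦ (1 : ℝ)) hnull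
  rw [← hmass]
  simp_rw [← (hasSum_alternating_choose_mul_choose k _).tsum_eq, ← integral_const_mul]
  refine hasSum_integral_of_summable_integral_norm (fun j ↦ (hint _).const_mul _) ?_
  simpa [norm_mul, integral_const_mul] using hsum

theorem tendsto_measureReal_eq_of_tendsto_integral_choose {ι : Type*} {l : Filter ι}
    {Ω : ι → Type*} [∀ i, MeasurableSpace (Ω i)] {P : ∀ i, Measure (Ω i)} {X : ∀ i, Ω i → ℕ}
    (hX : ∀ i, AEMeasurable (X i) (P i))
    (hint : ∀ i r, Integrable (fun ω ↦ ((X i ω).choose r : ℝ)) (P i)) {b B : ℕ → ℝ} {k : ℕ}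
    (hB : Summable fun j ↦ ((k + j).choose k : ℝ) * B (k + j))
    (hle : ∀ i r, ∫ ω, ((X i ω).choose r : ℝ) ∂P i ≤ B r)
    (hlim : ∀ r, Tendsto (fun i ↦ ∫ ω, ((X i ω).choose r : ℝ) ∂P i) l (nhds (b r))) :
    Tendsto (fun i ↦ (P i).real {ω | X i ω = k}) l
      (nhds (∑' j, (-1 : ℝ) ^ j * (k + j).choose k * b (k + j))) := by
  have hnonneg (i : ι) (r : ℕ) : 0 ≤ ∫ ω, ((X i ω).choose r : ℝ) ∂P i :=
    integral_nonneg fun _ ↦ Nat.cast_nonneg _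
  have hinversion (i : ι) := (hasSum_integral_choose (hX i) (hint i) (k := k)
    (hB.of_nonneg_of_le (fun j ↦ mul_nonneg (Nat.cast_nonneg _) (hnonneg i _))
      fun j ↦ mul_le_mul_of_nonneg_left (hle i _) (Nat.cast_nonneg _))).tsum_eq
  simp_rw [← hinversion]
  refine tendsto_tsum_of_dominated_convergence hB (fun j ↦ (hlim _).const_mul _) (.of_forall ?_)
  intro i j
  rw [norm_mul, norm_mul, norm_pow, norm_neg, norm_one, one_pow, one_mul, Real.norm_natCast,
    Real.norm_of_nonneg (hnonneg i _)]
  exact mul_le_mul_of_nonneg_left (hle i _) (Nat.cast_nonneg _)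

theorem hasSum_choose_mul_succ_mul_geometric {q : ℝ} (hq : ‖q‖ < 1) (k : ℕ) :
    HasSum (fun j ↦ ((k + j).choose k : ℝ) * (((k + j : ℕ) + 1) * q ^ (k + j)))
      ((k + 1) * q ^ k / (1 - q) ^ (k + 2)) := by
  have hfactor (j : ℕ) : ((k + j).choose k : ℝ) * (((k + j : ℕ) + 1) * q ^ (k + j)) =
      (k + 1) * q ^ k * ((j + (k + 1)).choose (k + 1) * q ^ j) := by
    have habsorb := Nat.add_one_mul_choose_eq (k + j) k
    rw [show k + j + 1 = j + (k + 1) by ring] at habsorb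
    have h : ((j + (k + 1)) * (k + j).choose k : ℝ) =
        (j + (k + 1)).choose (k + 1) * (k + 1) := by exact_mod_cast habsorb
    push_cast
    linear_combination q ^ k * q ^ j * h
  simpa only [hfactor, mul_one_div] using
    (hasSum_choose_mul_geometric_of_norm_lt_one (k + 1) hq).mul_left ((k + 1) * q ^ k)

theorem tsum_alternating_choose_mul_succ_mul_half_pow (k : ℕ) :
    ∑' j : ℕ, (-1 : ℝ) ^ j * (k + j).choose k * (((k + j : ℕ) + 1) * (1 / 2) ^ (k + j)) =
      4 / 9 * (k + 1) * (1 / 3) ^ k := by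
  have hsign (j : ℕ) : (-1 : ℝ) ^ j * (k + j).choose k * (((k + j : ℕ) + 1) * (1 / 2) ^ (k + j)) =
      (-1) ^ k * ((k + j).choose k * (((k + j : ℕ) + 1) * (-1 / 2) ^ (k + j))) := by
    have hsq : (-1 : ℝ) ^ k * (-1) ^ k = 1 := by rw [← mul_pow, neg_one_mul, neg_neg, one_pow]
    rw [neg_div, neg_pow (1 / 2 : ℝ) (k + j), pow_add (-1 : ℝ)]
    linear_combination
      -((-1 : ℝ) ^ j * (k + j).choose k * (((k + j : ℕ) + 1) * (1 / 2) ^ (k + j))) * hsq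
  simp_rw [hsign]
  rw [tsum_mul_left, (hasSum_choose_mul_succ_mul_geometric (by norm_num) k).tsum_eq]
  calc (-1 : ℝ) ^ k * ((k + 1) * (-1 / 2) ^ k / (1 - -1 / 2) ^ (k + 2))
      = 4 / 9 * (k + 1) * ((-1) ^ k * (-1 / 2) ^ k / (3 / 2) ^ k) := by
        rw [show (1 - -1 / 2 : ℝ) = 3 / 2 by norm_num, pow_add]
        ring
    _ = 4 / 9 * (k + 1) * (1 / 3) ^ k := by
        rw [← mul_pow, ← div_pow]
        norm_num

end BinomialMoments

section Probability

open Measure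

theorem geometricMeasure_conv_self_real_singleton {p : unitInterval} (hp : p ≠ 0) (k : ℕ) :
    (geometricMeasure p ∗ geometricMeasure p).real {k} = (k + 1) * p ^ 2 * (1 - p) ^ k := by
  have hfiber : (fun x : ℕ × ℕ ↦ x.1 + x.2) ⁻¹' {k} =
      (Finset.HasAntidiagonal.antidiagonal k : Set (ℕ × ℕ)) := by
    ext x
    simp
  rw [conv, map_measureReal_apply (by fun_prop) (measurableSet_singleton k), hfiber,
    ← sum_measureReal_singleton]
  have hmass : ∀ x ∈ Finset.HasAntidiagonal.antidiagonal k,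
      ((geometricMeasure p).prod (geometricMeasure p)).real {x} = p ^ 2 * (1 - p) ^ k := by
    rintro ⟨i, j⟩ hx
    rw [Finset.HasAntidiagonal.mem_antidiagonal] at hx
    rw [← Set.singleton_prod_singleton, measureReal_prod_prod, geometricMeasure_real_singleton hp,
      geometricMeasure_real_singleton hp, ← hx, pow_add]
    ring
  rw [Finset.sum_congr rfl hmass, Finset.sum_const, Finset.Nat.card_antidiagonal, nsmul_eq_mul]
  push_cast
  ring

theorem geometricTwoThirds_conv_self_real_singleton (k : ℕ) :
    (geometricTwoThirds ∗ geometricTwoThirds).real {k} = 4 / 9 * (k + 1) * (1 / 3) ^ k := by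
  rw [geometricTwoThirds, geometricMeasure_conv_self_real_singleton (by simp [Subtype.ext_iff])]
  norm_num
  ring

instance : IsProbabilityMeasure geometricTwoThirds :=
  isProbabilityMeasure_geometricMeasure

theorem integral_uniformOn_coe {α E : Type*} [Finite α] [MeasurableSpace α]
    [MeasurableSingletonClass α] [NormedAddCommGroup E] [NormedSpace ℝ E] [CompleteSpace E]
    (s : Finset α) (f : α → E) :
    ∫ x, f x ∂uniformOn (s : Set α) = (s.card : ℝ)⁻¹ • ∑ x ∈ s, f x := by
  rw [uniformOn, ProbabilityTheory.cond, integral_smul_measure, setIntegral_finset]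
  · simp
  · exact Integrable.of_finite

theorem tendsto_probabilityMeasure_of_tendsto_singleton {ι α : Type*} {l : Filter ι}
    [l.IsCountablyGenerated] [Countable α] [MeasurableSpace α] [MeasurableSingletonClass α]
    [TopologicalSpace α] [HasOuterApproxClosed α] [OpensMeasurableSpace α]
    {μs : ι → ProbabilityMeasure α} {μ : ProbabilityMeasure α}
    (h : ∀ a, Tendsto (fun i ↦ (μs i : Measure α).real {a}) l
      (nhds ((μ : Measure α).real {a}))) : Tendsto μs l (nhds μ) := by
  refine tendsto_of_forall_isOpen_le_liminf' fun G hG ↦ ?_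
  have hcount (ν : Measure α) : ν G = ∫⁻ a, G.indicator (fun x ↦ ν {x}) a ∂count := by
    rw [lintegral_count, tsum_indicator_apply_singleton ν G hG.measurableSet]
  have hENNReal (a : α) : Tendsto (fun i ↦ (μs i : Measure α) {a}) l
      (nhds ((μ : Measure α) {a})) :=
    (ENNReal.tendsto_toReal_iff (fun _ ↦ measure_ne_top _ _) (measure_ne_top _ _)).1 (h a)
  simp_rw [hcount]
  calc ∫⁻ a, G.indicator (fun x ↦ (μ : Measure α) {x}) a ∂count
      ≤ ∫⁻ a, liminf (fun i ↦ G.indicator (fun x ↦ (μs i : Measure α) {x}) a) l ∂count := by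
        refine lintegral_mono fun a ↦ ?_
        by_cases ha : a ∈ G
        · simp only [Set.indicator_of_mem ha]
          obtain rfl | hl := l.eq_or_neBot
          · simp
          · exact (hENNReal a).liminf_eq.ge
        · simp [Set.indicator_of_notMem ha]
    _ ≤ _ := lintegral_liminf_le fun i ↦ measurable_of_countable _

theorem tendstoInDistribution_of_tendsto_measureReal_eq {ι α Ω' : Type*} {Ω : ι → Type*}
    {l : Filter ι} [l.IsCountablyGenerated] [Countable α] [MeasurableSpace α]
    [MeasurableSingletonClass α] [TopologicalSpace α] [HasOuterApproxClosed α]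
    [OpensMeasurableSpace α] [∀ i, MeasurableSpace (Ω i)] [MeasurableSpace Ω']
    {P : ∀ i, Measure (Ω i)} [∀ i, IsProbabilityMeasure (P i)] {P' : Measure Ω'}
    [IsProbabilityMeasure P'] {X : ∀ i, Ω i → α} {Z : Ω' → α}
    (hX : ∀ i, AEMeasurable (X i) (P i)) (hZ : AEMeasurable Z P')
    (h : ∀ a, Tendsto (fun i ↦ (P i).real {ω | X i ω = a}) l (nhds (P'.real {ω | Z ω = a}))) :
    TendstoInDistribution X l Z P P' := by
  refine ⟨hX, hZ, tendsto_probabilityMeasure_of_tendsto_singleton fun a ↦ ?_⟩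
  simp only [ProbabilityMeasure.coe_mk,
    map_measureReal_apply_of_aemeasurable (hX _) (measurableSet_singleton a),
    map_measureReal_apply_of_aemeasurable hZ (measurableSet_singleton a)]
  exact h a

end Probability

section FixedPoints

instance (n : ℕ) : DiscreteMeasurableSpace (Equiv.Perm (Fin n)) :=
  ⟨fun _ ↦ trivial⟩

theorem aemeasurable_numFixedPoints {Ω : Type*} [MeasurableSpace Ω] {P : Measure Ω} {n : ℕ}
    {π : Ω → Equiv.Perm (Fin n)} (hπ : AEMeasurable π P) :
    AEMeasurable (fun ω ↦ numFixedPoints (π ω)) P :=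
  (Measurable.of_discrete (f := numFixedPoints)).comp_aemeasurable hπ

theorem integrable_choose_numFixedPoints {Ω : Type*} [MeasurableSpace Ω] {P : Measure Ω}
    [IsFiniteMeasure P] {n : ℕ} {π : Ω → Equiv.Perm (Fin n)} (hπ : AEMeasurable π P) (r : ℕ) :
    Integrable (fun ω ↦ ((numFixedPoints (π ω)).choose r : ℝ)) P :=
  (Integrable.of_finite (μ := P.map π)
    (f := fun τ ↦ ((numFixedPoints τ).choose r : ℝ))).comp_aemeasurable hπ

theorem integral_choose_numFixedPoints {σ : Equiv.Perm (Fin 3)} (hσ : σ = p132 ∨ σ = p213)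
    {Ω : Type*} [MeasurableSpace Ω] {P : Measure Ω} {n : ℕ} {π : Ω → Equiv.Perm (Fin n)}
    (hπ : HasLaw π (uniformOn (Av n σ)) P) (r : ℕ) :
    ∫ ω, ((numFixedPoints (π ω)).choose r : ℝ) ∂P =
      (r + 1) * (n.choose r / (2 * n).choose r) := by
  classical
  have hAv : Av n σ = (({τ | τ ∈ Av n σ} : Finset (Equiv.Perm (Fin n))) : Set _) := by simp
  have hcard : ({τ | τ ∈ Av n σ} : Finset (Equiv.Perm (Fin n))).card = catalan n := by
    simpa using sum_choose_numFixedPoints_av hσ n 0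
  rw [← coeff_X_pow_mul_catalanSeries_pow_div_catalan, ← sum_choose_numFixedPoints_av hσ, ← hcard,
    Nat.cast_sum, div_eq_inv_mul, ← smul_eq_mul, ← integral_uniformOn_coe, ← hAv]
  exact hπ.integral_comp (f := fun τ ↦ ((numFixedPoints τ).choose r : ℝ))
    Measurable.of_discrete.aestronglyMeasurable

theorem tendsto_measureReal_numFixedPoints_eq {σ : Equiv.Perm (Fin 3)}
    (hσ : σ = p132 ∨ σ = p213) {Ω : ℕ → Type*} [∀ n, MeasurableSpace (Ω n)]
    {P : ∀ n, Measure (Ω n)} [∀ n, IsFiniteMeasure (P n)] {π : ∀ n, Ω n → Equiv.Perm (Fin n)}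
    (hπ : ∀ n, HasLaw (π n) (uniformOn (Av n σ)) (P n)) (k : ℕ) :
    Tendsto (fun n ↦ (P n).real {ω | numFixedPoints (π n ω) = k}) atTop
      (nhds (4 / 9 * (k + 1) * (1 / 3) ^ k)) := by
  have hsum : Summable fun j ↦ ((k + j).choose k : ℝ) * (((k + j : ℕ) + 1) * (1 / 2) ^ (k + j)) :=
    (hasSum_choose_mul_succ_mul_geometric (by norm_num) k).summable
  have hle (n r : ℕ) : ∫ ω, ((numFixedPoints (π n ω)).choose r : ℝ) ∂P n ≤
      (r + 1) * (1 / 2) ^ r := by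
    rw [integral_choose_numFixedPoints hσ (hπ n)]
    exact mul_le_mul_of_nonneg_left (choose_div_choose_two_mul_le n r) (by positivity)
  have hlim (r : ℕ) : Tendsto (fun n ↦ ∫ ω, ((numFixedPoints (π n ω)).choose r : ℝ) ∂P n) atTop
      (nhds ((r + 1) * (1 / 2) ^ r)) := by
    simp_rw [integral_choose_numFixedPoints hσ (hπ _)]
    exact (tendsto_choose_div_choose_two_mul r).const_mul _
  rw [← tsum_alternating_choose_mul_succ_mul_half_pow]
  exact tendsto_measureReal_eq_of_tendsto_integral_choose
    (fun n ↦ aemeasurable_numFixedPoints (hπ n).aemeasurable)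
    (fun n ↦ integrable_choose_numFixedPoints (hπ n).aemeasurable)
    (B := fun r ↦ (r + 1) * (1 / 2) ^ r) (b := fun r ↦ (r + 1) * (1 / 2) ^ r) hsum hle hlim

end FixedPoints

end PatternAvoidance

theorem mainTheorem5 :
    -- the sum of two independent Geometric(2/3) variables has mass function `(4/9)(k+1)(1/3)^k`
    (∀ {Ω : Type*} [MeasurableSpace Ω] (P : Measure Ω) [IsProbabilityMeasure P] (A B : Ω → ℕ),
      HasLaw A geometricTwoThirds P → HasLaw B geometricTwoThirds P → IndepFun A B P →
      ∀ k : ℕ, P.real {ω | A ω + B ω = k} = 4 / 9 * ((k : ℝ) + 1) * (1 / 3 : ℝ) ^ k) ∧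
    -- the number of fixed points converges in distribution to any `Z` with that mass function
    (∀ σ : Equiv.Perm (Fin 3), σ = p132 ∨ σ = p213 →
      ∀ {Ω : ℕ → Type*} [∀ n, MeasurableSpace (Ω n)] (P : ∀ n, Measure (Ω n))
        [∀ n, IsProbabilityMeasure (P n)] (π : ∀ n, Ω n → Equiv.Perm (Fin n)),
      (∀ n, HasLaw (π n) (uniformOn (Av n σ)) (P n)) →
      ∀ {Ω' : Type*} [MeasurableSpace Ω'] (P' : Measure Ω') [IsProbabilityMeasure P']
        (Z : Ω' → ℕ), AEMeasurable Z P' →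
      (∀ k : ℕ, P'.real {ω | Z ω = k} = 4 / 9 * ((k : ℝ) + 1) * (1 / 3 : ℝ) ^ k) →
      TendstoInDistribution (fun n ω ↦ numFixedPoints (π n ω)) atTop Z P P') := by
  refine ⟨fun P _ A B hA hB hAB k ↦ ?_, fun σ hσ Ω _ P _ π hπ Ω' _ P' _ Z hZ hmass ↦ ?_⟩
  · rw [← geometricTwoThirds_conv_self_real_singleton k]
    exact (hAB.hasLaw_fun_add hA hB).measureReal_eq (p := (· = k)) (measurableSet_singleton k)
  · refine tendstoInDistribution_of_tendsto_measureReal_eq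
      (fun n ↦ aemeasurable_numFixedPoints (hπ n).aemeasurable) hZ fun k ↦ ?_
    rw [hmass]
    exact tendsto_measureReal_numFixedPoints_eq hσ hπ k
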